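/- Online logistic regression. In round $t=1,\dots,T$ a feature vector $x_t\in[-1,1]^d$ is revealed, an algorithm $\mathcal A$ assigns, from $S_{t-1}=((x_s,y_s))_{s<t}$ and $x_t$, probabilities $\mathcal A(S_{t-1},x_t,\cdot)$ (summing to $1$) to the two labels $\{-1,1\}$, and then $y_t\in\{-1,1\}$ is revealed. With $p(y\mid x,\theta)=1/(1+\exp(-y\,x^{\mathsf T}\theta))$ for $\theta\in\mathbb R^d$, the regret of $\mathcal A$ on $S_T=((x_t,y_t))_{t\le T}$ is $$\mathrm{Regret}(\mathcal A,S_T)=\sup_{\|\theta\|_\rho\le B}\Big[\sum_{t=1}^T-\log\mathcal A(S_{t-1},x_t,y_t)+\sum_{t=1}^T\log p(y_t\mid x_t,\theta)\Big]\in(-\infty,+\infty],$$ where $\rho\in\{1,2,\infty\}$, $B>0$, and $\log$ is natural. For $\varepsilon>0$, $T\ge 2$ and $d\ge1$ put $$\gamma=\min\Big\{\frac{B}{\log T},\ \frac{T^{1-\varepsilon}}{\min(T^{1-\varepsilon},d)}\Big\}.$$ **Theorem.** Fix $\varepsilon>0$ and let $T\to\infty$, where $d\ge 1$ and $B$ may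 depend on $T$ and $B\ge T^{-o(1)}$ (for example $B$ bounded below by a positive constant). Then for every algorithm $\mathcal A$ there is a sequence $S_T$ with all $x_t\in[-1,1]^d$ such that $\mathrm{Regret}(\mathcal A,S_T)$ is at least 1. $(1-o(1))\,\frac d2\log\frac Td$, if $d=O(1)$, for each $\rho\in\{1,2,\infty\}$; 2. $(1-o(1))\,\frac d2\log\frac{4\gamma T}{d}$, if $\rho=\infty$ and $d<\frac4e\gamma T^{1-\varepsilon}$; 3. $(1-o(1))\,\frac2e\gamma T^{1-\varepsilon}$, if $\rho=\infty$ and $d\ge\frac4e\gamma T^{1-\varepsilon}$; 4. $(1-o(1))\,\frac d2\log\frac{2\pi e\gamma T}{d^2}$, if $\rho=2$ and $d<\sqrt{\frac{2\pi}e\gamma T^{1-\varepsilon}}$; 5. $(1-o(1))\,\sqrt{\frac{2\pi}e\gamma T^{1-\varepsilon}}$, if $\rho=2$ and $d\ge\sqrt{\frac{2\pi}e\gamma T^{1-\varepsilon}}$; 6. $(1-o(1))\,\frac d2\log\frac{4e^2\gamma T}{d^3}$, if $\rho=1$ and $d<\big(\frac{4\gamma T^{1-\varepsilon}}e\big)^{1/3}$;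 7. $(1-o(1))\,\frac32\big(\frac{4\gamma T^{1-\varepsilon}}e\big)^{1/3}$, if $\rho=1$ and $d\ge\big(\frac{4\gamma T^{1-\varepsilon}}e\big)^{1/3}$; where in 2, 4 and 6 it is assumed that $d\to\infty$ or $\gamma\le T^{o(1)}$. The $o(1)$ in the bounds does not depend on $\mathcal A$ and is uniform in $d$ and $B$: for all $\varepsilon,\eta>0$ and $D$ there are $\delta>0$, $T_0$, $D_0$ such that for all $T\ge T_0$, $d\ge1$ and $B\ge T^{-\delta}$ each bound holds with $1-\eta$ in place of $1-o(1)$, where "$d=O(1)$" means $d\le D$, and in 2, 4 and 6 it is assumed that $d\ge D_0$ or $\gamma\le T^\delta$. -/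

import Mathlib

open scoped ENNReal

noncomputable section

namespace OnlineLogistic

/-- Feature vectors (and parameter vectors) of dimension `d`. -/
abbrev Vec (d : ℕ) : Type := Fin d → ℝ

/-- An example together with its label; the label set `{-1, 1}` is `ℤˣ`. -/
abbrev Example (d : ℕ) : Type := Vec d × ℤˣ

/-- An online algorithm: from the `n` labelled examples seen so far and the current feature
vector it returns a probability distribution over the label in `{-1, 1}`. -/
abbrev Algorithm (d : ℕ) : Type := (n : ℕ) → (Fin n → Example d) → Vec d → PMF ℤˣ

/-- The logistic model: the probability of label `y` for features `x` under parameter `θ`. -/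
def modelProb {d : ℕ} (θ x : Vec d) (y : ℤˣ) : ℝ :=
  1 / (1 + Real.exp (-(((y : ℤ) : ℝ) * ∑ i, x i * θ i)))

/-- Total logarithmic loss of the fixed parameter `θ` on the sequence `S`. -/
def modelLoss {d T : ℕ} (θ : Vec d) (S : Fin T → Example d) : ℝ :=
  ∑ t, -Real.log (modelProb θ (S t).1 (S t).2)

/-- Total logarithmic loss of the algorithm `A` on the sequence `S`. It lives in the extended
reals: it is `⊤` as soon as `A` gives probability `0` to a label that occurs. -/
def algLoss {d T : ℕ} (A : Algorithm d) (S : Fin T → Example d) : EReal :=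
  ∑ t : Fin T,
    -ENNReal.log (A t (fun s : Fin (t : ℕ) => S (Fin.castLE t.isLt.le s)) (S t).1 (S t).2)

/-- The comparator class: the ball of radius `B` of the `ℓ^ρ` norm. -/
def comparators (ρ : ℝ≥0∞) (d : ℕ) (B : ℝ) : Set (Vec d) :=
  {θ | ‖WithLp.toLp ρ θ‖ ≤ B}

/-- Regret of `A` on `S` relative to the comparator `θ`. -/
def regretAgainst {d T : ℕ} (A : Algorithm d) (S : Fin T → Example d) (θ : Vec d) : EReal :=
  algLoss A S - (modelLoss θ S : EReal)

/-- Regret of `A` on `S` relative to the best comparator of `Θ`. -/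
def regret {d T : ℕ} (Θ : Set (Vec d)) (A : Algorithm d) (S : Fin T → Example d) : EReal :=
  ⨆ θ ∈ Θ, regretAgainst A S θ

/-- For every algorithm there is a sequence of length `T`, with all features in `[-1, 1]`, on
which its regret against the `ℓ^ρ` ball of radius `B` is at least `r`. -/
def RegretForced (ρ : ℝ≥0∞) (T d : ℕ) (B r : ℝ) : Prop :=
  ∀ A : Algorithm d, ∃ S : Fin T → Example d,
    (∀ t i, |(S t).1 i| ≤ 1) ∧ (r : EReal) ≤ regret (comparators ρ d B) A S

/-- The effective number of `log T` units in `B`: the minimum of `B / log T` and of the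
solution `α` of `α * min (T ^ (1 - ε)) d = T ^ (1 - ε)`. -/
def effGamma (ε : ℝ) (T d : ℕ) (B : ℝ) : ℝ :=
  min (B / Real.log T) ((T : ℝ) ^ (1 - ε) / min ((T : ℝ) ^ (1 - ε)) (d : ℝ))

end OnlineLogistic

end

/-!
The lower bounds come from Shtarkov's argument. Fix the features in advance and choose a comparator
`g y` for each label sequence `y`. An algorithm gives the label sequences probabilities of total
mass `1`, so on some `y` its regret is at least `log ∑ y, p_{g y}(y)` (`exists_log_le_regret`). If
every round involves only one of `k` free parameters, the sum is a `k`-th power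
(`regretForced_of_shtarkovSumGE`), which leaves a one-parameter problem.

With a parameter in `[0, b]`, `b ≤ 1`, and `m` rounds, the parameters whose label means are `4 / √m`
apart are told apart by the sum of the labels, by Chebyshev's inequality, so the sum is at least a
constant times `b √m` (`exists_le_sum_mixed`). With a large radius one coordinate is fixed as a
reference. The features then compare the other coordinates with `K` offsets at a distance `L` of
order `log T`: far offsets give deterministic labels, so the `K` local sums add up to a constant
times `K √m`, with about `m = T / (d K)` rounds for each offset (`shtarkovSumGE_offsets`). This is
where the factor `γ ≈ B / log T` in the bounds comes from.

For `κ = 2 / ρ`, the `ℓ^ρ` ball of radius `B` contains a box of side `B / d ^ (κ / 2)`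
(`BoxBound`), and the logarithmic bounds all have the form `(d / 2) log (C' γ T / d ^ (κ + 1))`.
Below the critical dimension the logarithm is at least `ε log T - O(1)`, so constants and factors
`T ^ δ` are absorbed by `η` (`regretForced_below`). Above it, the bounds lack the logarithm, and a
number of coordinates close to the critical dimension, in a box of side at most `1`, is more than
enough (`regretForced_above`).
-/

namespace OnlineLogistic

open Finset Filter

/-! ### Sequential probability assignments and the Shtarkov bound -/

theorem modelProb_eq_sigmoid {d : ℕ} (θ x : Vec d) (y : ℤˣ) :
    modelProb θ x y = Real.sigmoid (((y : ℤ) : ℝ) * ∑ i, x i * θ i) := by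
  simp [modelProb, Real.sigmoid]

theorem modelProb_pos {d : ℕ} (θ x : Vec d) (y : ℤˣ) : 0 < modelProb θ x y := by
  rw [modelProb_eq_sigmoid]; exact Real.sigmoid_pos _

/-- Chained conditional distributions define a distribution on sequences. -/
theorem sum_prod_sequential (F : (n : ℕ) → (Fin n → ℤˣ) → PMF ℤˣ) (T : ℕ) :
    ∑ y : Fin T → ℤˣ, ∏ t : Fin T, F t (fun s : Fin (t : ℕ) => y (Fin.castLE t.isLt.le s)) (y t)
      = 1 := by
  induction T with
  | zero => simp
  | succ T ih =>
    rw [← (Fin.snocEquiv (fun _ : Fin (T + 1) => ℤˣ)).sum_comp, Fintype.sum_prod_type,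
      Finset.sum_comm, ← ih]
    refine Finset.sum_congr rfl fun y _ => ?_
    have hlast : ∀ z : ℤˣ, ∏ t : Fin (T + 1), F t (fun s : Fin (t : ℕ) =>
        (Fin.snoc y z : Fin (T + 1) → ℤˣ) (Fin.castLE t.isLt.le s))
          ((Fin.snoc y z : Fin (T + 1) → ℤˣ) t)
        = (∏ t : Fin T, F t (fun s : Fin (t : ℕ) => y (Fin.castLE t.isLt.le s)) (y t))
          * F T y z := by
      intro z
      rw [Fin.prod_univ_castSucc]
      congr 1
      · refine Finset.prod_congr rfl fun t _ => ?_
        have h : ∀ s : Fin (t : ℕ), (Fin.snoc y z : Fin (T + 1) → ℤˣ)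
            (Fin.castLE t.castSucc.isLt.le s) = y (Fin.castLE t.isLt.le s) := fun s =>
          Fin.snoc_castSucc (α := fun _ => ℤˣ) z y (Fin.castLE t.isLt.le s)
        have h2 : (Fin.snoc y z : Fin (T + 1) → ℤˣ) t.castSucc = y t :=
          Fin.snoc_castSucc (α := fun _ => ℤˣ) z y t
        rw [h2]
        exact congrArg (fun w => F t w (y t)) (funext h)
      · have h : ∀ s : Fin T, (Fin.snoc y z : Fin (T + 1) → ℤˣ)
            (Fin.castLE (Fin.last T).isLt.le s) = y s := fun s =>
          Fin.snoc_castSucc (α := fun _ => ℤˣ) z y s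
        have h2 : (Fin.snoc y z : Fin (T + 1) → ℤˣ) (Fin.last T) = z :=
          Fin.snoc_last (α := fun _ => ℤˣ) z y
        rw [h2]
        exact congrArg (fun w => F T w z) (funext h)
    have hsum : ∑ z : ℤˣ, F T y z = 1 := by
      rw [← tsum_fintype (L := .unconditional _)]; exact (F T y).tsum_coe
    calc _ = ∑ z : ℤˣ, (∏ t : Fin T, F t (fun s : Fin (t : ℕ) =>
          y (Fin.castLE t.isLt.le s)) (y t)) * F T y z :=
          Finset.sum_congr rfl fun z _ => hlast z
      _ = _ := by rw [← Finset.mul_sum, hsum, mul_one]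

theorem ereal_coe_sum {ι : Type*} (s : Finset ι) (f : ι → ℝ) :
    ((∑ i ∈ s, f i : ℝ) : EReal) = ∑ i ∈ s, (f i : EReal) := by
  classical
  induction s using Finset.induction_on with
  | empty => simp
  | insert i s hi ih => rw [Finset.sum_insert hi, Finset.sum_insert hi, EReal.coe_add, ih]

/-- The total loss of an assignment `a` of probabilities at the rounds, in the extended reals,
is at least `r` once the product of the probabilities is at most `exp (-r)`. -/
theorem le_sum_neg_log {T : ℕ} (a : Fin T → ℝ≥0∞) (ha : ∀ t, a t ≤ 1) {r : ℝ}
    (h : (∏ t, a t).toReal ≤ Real.exp (-r)) : (r : EReal) ≤ ∑ t, -ENNReal.log (a t) := by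
  by_cases h0 : ∃ s, a s = 0
  · obtain ⟨s, hs⟩ := h0
    have hle : -ENNReal.log (a s) ≤ ∑ t, -ENNReal.log (a t) := by
      refine Finset.single_le_sum (f := fun t => -ENNReal.log (a t)) (fun t _ => ?_)
        (Finset.mem_univ s)
      rw [EReal.neg_nonneg]
      exact (ENNReal.log_monotone (ha t)).trans ENNReal.log_one.le
    rw [hs, ENNReal.log_zero, EReal.neg_bot] at hle
    exact le_top.trans hle
  · push Not at h0
    have hpos : ∀ t, 0 < (a t).toReal := fun t =>
      ENNReal.toReal_pos (h0 t) (ne_top_of_le_ne_top ENNReal.one_ne_top (ha t))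
    have hterm : ∀ t, -ENNReal.log (a t) = ((-Real.log (a t).toReal : ℝ) : EReal) := fun t => by
      rw [ENNReal.log_pos_real (h0 t) (ne_top_of_le_ne_top ENNReal.one_ne_top (ha t)),
        EReal.coe_neg]
    simp_rw [hterm]
    rw [← ereal_coe_sum, EReal.coe_le_coe_iff, Finset.sum_neg_distrib,
      ← Real.log_prod (fun t _ => (hpos t).ne')]
    rw [ENNReal.toReal_prod] at h
    have := Real.log_le_log (Finset.prod_pos fun t _ => hpos t) h
    rw [Real.log_exp] at this
    linarith

/-- **Shtarkov's bound.** For a fixed design `x` and any choice `g` of a comparator for each label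
sequence, some label sequence forces regret at least the logarithm of the total selected
likelihood, because the probabilities that the algorithm assigns to the label sequences sum
to `1`. -/
theorem exists_log_le_regret {d T : ℕ} {Θ : Set (Vec d)} (A : Algorithm d) (x : Fin T → Vec d)
    (g : (Fin T → ℤˣ) → Vec d) (hg : ∀ y, g y ∈ Θ) {Z : ℝ} (hZ : 0 < Z)
    (h : Z ≤ ∑ y : Fin T → ℤˣ, ∏ t, modelProb (g y) (x t) (y t)) :
    ∃ y : Fin T → ℤˣ, (Real.log Z : EReal) ≤ regret Θ A (fun t => (x t, y t)) := by
  -- The algorithm as a function of the labels alone, the design being extended by `0`.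
  let X : ℕ → Vec d := fun n => if hn : n < T then x ⟨n, hn⟩ else 0
  let F : (n : ℕ) → (Fin n → ℤˣ) → PMF ℤˣ := fun n w => A n (fun s => (X s, w s)) (X n)
  let a : (Fin T → ℤˣ) → Fin T → ℝ≥0∞ := fun y t =>
    F t (fun s : Fin (t : ℕ) => y (Fin.castLE t.isLt.le s)) (y t)
  have hX : ∀ t : Fin T, X t = x t := fun t => by simp [X]
  have ha1 : ∀ y t, a y t ≤ 1 := fun y t => PMF.coe_le_one _ _
  have halg : ∀ y, algLoss A (fun t => (x t, y t)) = ∑ t, -ENNReal.log (a y t) := by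
    intro y
    refine Finset.sum_congr rfl fun t _ => ?_
    simp only [a, F, hX]
    congr 4
    funext s
    rw [← hX (Fin.castLE t.isLt.le s)]
    rfl
  have hsum : ∑ y, (∏ t, a y t).toReal = 1 := by
    rw [← ENNReal.toReal_sum (fun y _ => ne_top_of_le_ne_top ENNReal.one_ne_top
      (Finset.prod_le_one' fun t _ => ha1 y t))]
    rw [show ∑ y, ∏ t, a y t = 1 from sum_prod_sequential F T]
    rfl
  obtain ⟨y, -, hy⟩ : ∃ y ∈ (Finset.univ : Finset (Fin T → ℤˣ)),
      (∏ t, a y t).toReal * Z ≤ ∏ t, modelProb (g y) (x t) (y t) := by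
    refine Finset.exists_le_of_sum_le Finset.univ_nonempty ?_
    rw [← Finset.sum_mul, hsum, one_mul]
    exact h
  refine ⟨y, le_iSup₂_of_le (g y) (hg y) ?_⟩
  have hPpos : 0 < ∏ t, modelProb (g y) (x t) (y t) :=
    Finset.prod_pos fun t _ => modelProb_pos _ _ _
  have hloss : modelLoss (g y) (fun t => (x t, y t))
      = -Real.log (∏ t, modelProb (g y) (x t) (y t)) := by
    rw [Real.log_prod (fun t _ => (modelProb_pos _ _ _).ne'), ← Finset.sum_neg_distrib]
    rfl
  have hkey : ((Real.log Z - Real.log (∏ t, modelProb (g y) (x t) (y t)) : ℝ) : EReal)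
      ≤ algLoss A (fun t => (x t, y t)) := by
    rw [halg]
    refine le_sum_neg_log _ (ha1 y) ?_
    rw [neg_sub, Real.exp_sub, Real.exp_log hPpos, Real.exp_log hZ, le_div_iff₀ hZ]
    exact hy
  rw [regretAgainst, hloss]
  refine (EReal.le_sub_iff_add_le (Or.inl (EReal.coe_ne_bot _))
    (Or.inl (EReal.coe_ne_top _))).2 ?_
  rw [← EReal.coe_add, ← sub_eq_add_neg]
  exact hkey

theorem RegretForced.mono {ρ : ℝ≥0∞} {T d : ℕ} {B r s : ℝ} (h : RegretForced ρ T d B r)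
    (hsr : s ≤ r) : RegretForced ρ T d B s := by
  intro A
  obtain ⟨S, hS, hr⟩ := h A
  exact ⟨S, hS, (EReal.coe_le_coe_iff.2 hsr).trans hr⟩

/-- `Z` is a lower bound for the total likelihood `∑ y, p_{g y}(y)` of the one-parameter logistic
problem with offsets `c`, for some choice `g` of a parameter in `U` for each label sequence. -/
def ShtarkovSumGE {J : Type} [Fintype J] [DecidableEq J] (c : J → ℝ) (U : Set ℝ) (Z : ℝ) : Prop :=
  ∃ g : (J → ℤˣ) → ℝ, (∀ y, g y ∈ U) ∧
    Z ≤ ∑ y : J → ℤˣ, ∏ j, Real.sigmoid (((y j : ℤ) : ℝ) * (g y - c j))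

/-- A design made of `k` groups of rounds, the `i`-th of which sees only the `i`-th of `k` free
parameters, has as its Shtarkov sum the `k`-th power of that of a single group. Rounds left over
get the zero feature. -/
theorem regretForced_of_shtarkovSumGE {J : Type} [Fintype J] [DecidableEq J] {ρ : ℝ≥0∞}
    {T d k : ℕ} {B Z : ℝ}
    {c : J → ℝ} {U : Set ℝ} (hZ : 0 < Z) (hS : ShtarkovSumGE c U Z)
    (embed : (Fin k → ℝ) → Vec d) (x : Fin k × J → Vec d) (hx : ∀ p i, |x p i| ≤ 1)
    (hdot : ∀ u p, ∑ i, x p i * embed u i = u p.1 - c p.2)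
    (hmem : ∀ u, (∀ i, u i ∈ U) → embed u ∈ comparators ρ d B)
    (hcard : k * Fintype.card J ≤ T) :
    RegretForced ρ T d B (k * Real.log Z) := by
  intro A
  obtain ⟨g, hgU, hgZ⟩ := hS
  have hc : Fintype.card ((Fin k × J) ⊕ Fin (T - k * Fintype.card J)) = Fintype.card (Fin T) := by
    simp only [Fintype.card_sum, Fintype.card_prod, Fintype.card_fin]
    omega
  let e := Fintype.equivOfCardEq hc
  let x' : Fin T → Vec d := fun t => Sum.elim x (fun _ => 0) (e.symm t)
  let g' : (Fin T → ℤˣ) → Vec d := fun y => embed fun i => g fun j => y (e (Sum.inl (i, j)))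
  have hsum : Z ^ k ≤ ∑ y : Fin T → ℤˣ, ∏ t, modelProb (g' y) (x' t) (y t) := by
    have h1 : ∀ y : Fin T → ℤˣ, ∏ t, modelProb (g' y) (x' t) (y t)
        = (∏ i, ∏ j, Real.sigmoid (((y (e (Sum.inl (i, j))) : ℤ) : ℝ)
            * (g (fun j => y (e (Sum.inl (i, j)))) - c j)))
          * (1 / 2 : ℝ) ^ (T - k * Fintype.card J) := by
      intro y
      rw [← e.prod_comp, Fintype.prod_sum_type]
      congr 1
      · rw [Fintype.prod_prod_type]
        refine Finset.prod_congr rfl fun i _ => Finset.prod_congr rfl fun j _ => ?_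
        rw [modelProb_eq_sigmoid]
        simp only [x', g', Equiv.symm_apply_apply, Sum.elim_inl, hdot]
      · rw [Finset.prod_congr rfl (g := fun _ => (1 / 2 : ℝ))]
        · simp
        · intro s _
          simp [modelProb, x']
          norm_num
    -- Reindex the label sequences by the groups and the left-over rounds.
    let E : (Fin T → ℤˣ) ≃ (Fin k → J → ℤˣ) × (Fin (T - k * Fintype.card J) → ℤˣ) :=
      ((Equiv.arrowCongr e.symm (Equiv.refl ℤˣ)).trans
        (Equiv.sumArrowEquivProdArrow _ _ _)).trans
        (Equiv.prodCongr (Equiv.curry _ _ _) (Equiv.refl _))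
    have h2 : ∀ y : Fin T → ℤˣ, ∏ t, modelProb (g' y) (x' t) (y t)
        = (∏ i, ∏ j, Real.sigmoid ((((E y).1 i j : ℤ) : ℝ) * (g ((E y).1 i) - c j)))
          * (1 / 2 : ℝ) ^ (T - k * Fintype.card J) := fun y => h1 y
    simp_rw [h2]
    rw [E.sum_comp (fun p => (∏ i, ∏ j, Real.sigmoid (((p.1 i j : ℤ) : ℝ) * (g (p.1 i) - c j)))
          * (1 / 2 : ℝ) ^ (T - k * Fintype.card J)), Fintype.sum_prod_type]
    simp only [Finset.sum_const, Finset.card_univ, Fintype.card_fun, Fintype.card_fin,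
      Fintype.card_units_int, nsmul_eq_mul]
    have h3 : ∀ r : ℕ, ∀ v : ℝ, ((2 ^ r : ℕ) : ℝ) * (v * (1 / 2 : ℝ) ^ r) = v := by
      intro r v
      push_cast
      rw [mul_left_comm, ← mul_pow]
      norm_num
    simp_rw [h3]
    rw [← Fintype.sum_pow (fun w : J → ℤˣ =>
      ∏ j, Real.sigmoid (((w j : ℤ) : ℝ) * (g w - c j))) k]
    exact pow_le_pow_left₀ hZ.le hgZ k
  obtain ⟨y, hy⟩ := exists_log_le_regret A x' g' (fun y => hmem _ fun i => hgU _)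
    (pow_pos hZ k) hsum
  refine ⟨fun t => (x' t, y t), fun t i => ?_, ?_⟩
  · rcases h : e.symm t with p | s
    · simpa [x', h] using hx p i
    · simp [x', h]
  · rwa [Real.log_pow] at hy

/-! ### One-parameter problems -/

theorem sum_units_int (f : ℤˣ → ℝ) : ∑ z : ℤˣ, f z = f 1 + f (-1) := by
  rw [show (Finset.univ : Finset ℤˣ) = {1, -1} from rfl]
  exact Finset.sum_pair (by decide)

theorem sum_sigmoid_units (u : ℝ) : ∑ z : ℤˣ, Real.sigmoid (((z : ℤ) : ℝ) * u) = 1 := by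
  rw [sum_units_int]
  simp [Real.sigmoid_neg]

/-- Second moment of a sum of independent centred terms, about any point. -/
theorem sum_prod_mul_sq (w z : ℤˣ → ℝ) (hw : ∑ s, w s = 1) (hz : ∑ s, w s * z s = 0) (m : ℕ)
    (a : ℝ) : ∑ y : Fin m → ℤˣ, (∏ j, w (y j)) * (a + ∑ j, z (y j)) ^ 2
      = a ^ 2 + m * ∑ s, w s * z s ^ 2 := by
  induction m generalizing a with
  | zero => simp
  | succ m ih =>
    rw [← (Fin.consEquiv (fun _ : Fin (m + 1) => ℤˣ)).sum_comp, Fintype.sum_prod_type]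
    have h : ∀ s : ℤˣ, ∑ y : Fin m → ℤˣ,
        (∏ j, w ((Fin.consEquiv (fun _ : Fin (m + 1) => ℤˣ)) (s, y) j))
          * (a + ∑ j, z ((Fin.consEquiv (fun _ : Fin (m + 1) => ℤˣ)) (s, y) j)) ^ 2
        = w s * ((a + z s) ^ 2 + m * ∑ s, w s * z s ^ 2) := by
      intro s
      rw [← ih (a + z s), Finset.mul_sum]
      refine Finset.sum_congr rfl fun y _ => ?_
      rw [Fin.prod_univ_succ, Fin.sum_univ_succ]
      simp only [Fin.consEquiv_apply, Fin.cons_zero, Fin.cons_succ]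
      ring
    simp_rw [h]
    rw [sum_units_int] at hw hz ⊢
    rw [sum_units_int]
    push_cast
    linear_combination (a ^ 2 + m * (w 1 * z 1 ^ 2 + w (-1) * z (-1) ^ 2)) * hw + 2 * a * hz

/-- Chebyshev's inequality for `m` labels of mean `μ`: with probability at least `3 / 4` their sum
is within `2 √m` of `m μ`. -/
theorem three_quarters_le_sum_near_mean {μ u : ℝ} (hu : Real.sigmoid u = (1 + μ) / 2) {m : ℕ}
    (hm : 0 < m) :
    3 / 4 ≤ ∑ y : Fin m → ℤˣ with |∑ j, ((y j : ℤ) : ℝ) - m * μ| < 2 * √m,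
      ∏ j, Real.sigmoid (((y j : ℤ) : ℝ) * u) := by
  classical
  have hm' : (0 : ℝ) < m := by exact_mod_cast hm
  set w : ℤˣ → ℝ := fun s => Real.sigmoid (((s : ℤ) : ℝ) * u) with hwdef
  have hw1 : w 1 = (1 + μ) / 2 := by simp [hwdef, hu]
  have hw2 : w (-1) = (1 - μ) / 2 := by simp [hwdef, Real.sigmoid_neg, hu]; ring
  have hw : ∑ s, w s = 1 := sum_sigmoid_units u
  have hz : ∑ s, w s * (((s : ℤ) : ℝ) - μ) = 0 := by
    rw [sum_units_int, hw1, hw2]; push_cast; ring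
  have hv : ∑ s, w s * (((s : ℤ) : ℝ) - μ) ^ 2 ≤ 1 := by
    rw [sum_units_int, hw1, hw2]; push_cast; nlinarith [sq_nonneg μ]
  have hmom := sum_prod_mul_sq w (fun s => ((s : ℤ) : ℝ) - μ) hw hz m 0
  have hprod : ∀ y : Fin m → ℤˣ, 0 ≤ ∏ j, w (y j) := fun y =>
    Finset.prod_nonneg fun j _ => (Real.sigmoid_pos _).le
  have htot : ∑ y : Fin m → ℤˣ, ∏ j, w (y j) = 1 := by
    have := Fintype.sum_pow w m
    rw [hw, one_pow] at this
    exact this.symm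
  have hsplit := Finset.sum_filter_add_sum_filter_not (Finset.univ : Finset (Fin m → ℤˣ))
    (fun y => |∑ j, ((y j : ℤ) : ℝ) - m * μ| < 2 * √m) (fun y => ∏ j, w (y j))
  rw [htot] at hsplit
  have htail : 4 * m * ∑ y : Fin m → ℤˣ with ¬ |∑ j, ((y j : ℤ) : ℝ) - m * μ| < 2 * √m,
      ∏ j, w (y j) ≤ m := by
    calc _ ≤ ∑ y : Fin m → ℤˣ with ¬ |∑ j, ((y j : ℤ) : ℝ) - m * μ| < 2 * √m,
          (∏ j, w (y j)) * (0 + ∑ j, (((y j : ℤ) : ℝ) - μ)) ^ 2 := by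
          rw [Finset.mul_sum]
          refine Finset.sum_le_sum fun y hy => ?_
          have hy' := (Finset.mem_filter.1 hy).2
          rw [not_lt] at hy'
          have hs : 0 + ∑ j, (((y j : ℤ) : ℝ) - μ) = ∑ j, ((y j : ℤ) : ℝ) - m * μ := by
            rw [Finset.sum_sub_distrib]; simp
          rw [hs, mul_comm]
          refine mul_le_mul_of_nonneg_left ?_ (hprod y)
          have := pow_le_pow_left₀ (by positivity) hy' 2
          rw [sq_abs, mul_pow, Real.sq_sqrt hm'.le] at this
          linarith
      _ ≤ ∑ y : Fin m → ℤˣ, (∏ j, w (y j)) * (0 + ∑ j, (((y j : ℤ) : ℝ) - μ)) ^ 2 :=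
          Finset.sum_le_sum_of_subset_of_nonneg (Finset.filter_subset _ _)
            fun y _ _ => mul_nonneg (hprod y) (sq_nonneg _)
      _ ≤ m := by
          rw [hmom]
          nlinarith
  have : ∑ y : Fin m → ℤˣ with ¬ |∑ j, ((y j : ℤ) : ℝ) - m * μ| < 2 * √m,
      ∏ j, w (y j) ≤ 1 / 4 := by
    rw [← mul_le_mul_iff_right₀ (show (0 : ℝ) < 4 * m by positivity)]
    linarith
  linarith

/-- The parameter `2 artanh μ` at which a label has mean `μ`. -/
noncomputable def meanParam (μ : ℝ) : ℝ := Real.log ((1 + μ) / (1 - μ))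

theorem sigmoid_meanParam {μ : ℝ} (h0 : 0 ≤ μ) (h1 : μ < 1) :
    Real.sigmoid (meanParam μ) = (1 + μ) / 2 := by
  have h2 : 0 < 1 - μ := by linarith
  have h3 : 0 < 1 + μ := by linarith
  rw [Real.sigmoid, meanParam, Real.exp_neg, Real.exp_log (by positivity)]
  field_simp
  ring

theorem meanParam_mem {μ b : ℝ} (h0 : 0 ≤ μ) (h1 : 4 * μ ≤ b) (hb : b ≤ 1) :
    meanParam μ ∈ Set.Icc 0 b := by
  have h2 : 0 < 1 - μ := by linarith
  constructor
  · exact Real.log_nonneg (by rw [le_div_iff₀ h2]; linarith)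
  · refine (Real.log_le_sub_one_of_pos (by positivity)).trans ?_
    rw [sub_le_iff_le_add, div_le_iff₀ h2]
    nlinarith

/-- Label sequences in which both labels occur. -/
def Mixed {m : ℕ} (y : Fin m → ℤˣ) : Prop := (∃ j, y j = 1) ∧ ∃ j, y j = -1

theorem mixed_of_sum_lt {m : ℕ} {y : Fin m → ℤˣ} (h1 : ∑ j, ((y j : ℤ) : ℝ) < m)
    (h2 : -(m : ℝ) < ∑ j, ((y j : ℤ) : ℝ)) : Mixed y := by
  constructor
  · by_contra! h
    have : ∀ j, y j = -1 := fun j => (Int.units_eq_one_or (y j)).resolve_left (h j)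
    simp [this] at h2
  · by_contra! h
    have : ∀ j, y j = 1 := fun j => (Int.units_eq_one_or (y j)).resolve_right (h j)
    simp [this] at h1

open Classical in
/-- Parameters whose means are `4 / √m` apart are told apart by the sum of `m` labels, and an
interval of length `b ≤ 1` contains of the order of `b √m` of them. The label sequences that are
used are mixed. -/
theorem exists_le_sum_mixed {m : ℕ} (hm : 8 ≤ m) {b : ℝ} (hb0 : 0 < b) (hb1 : b ≤ 1) :
    ∃ g : (Fin m → ℤˣ) → ℝ, (∀ y, g y ∈ Set.Icc 0 b) ∧
      3 / 64 * b * √m ≤ ∑ y : Fin m → ℤˣ with Mixed y,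
        ∏ j, Real.sigmoid (((y j : ℤ) : ℝ) * g y) := by
  have hm' : (8 : ℝ) ≤ m := by exact_mod_cast hm
  have hsm : 0 < √(m : ℝ) := Real.sqrt_pos.2 (by linarith)
  have hss : √(m : ℝ) * √m = m := Real.mul_self_sqrt (by linarith)
  -- The means of the net are `4 a / √m` for `a ≤ N`; all lie in `[0, b / 4]`.
  set N : ℕ := ⌊b * √m / 16⌋₊ with hN
  have hNle : (N : ℝ) ≤ b * √m / 16 := Nat.floor_le (by positivity)
  have hNlt : b * √m / 16 < N + 1 := Nat.lt_floor_add_one _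
  let mu : ℕ → ℝ := fun a => 4 * a / √m
  have hmu0 : ∀ a, 0 ≤ mu a := fun a => by positivity
  have hmub : ∀ a ≤ N, 4 * mu a ≤ b := by
    intro a ha
    have ha' : (a : ℝ) ≤ N := by exact_mod_cast ha
    have : mu a ≤ b / 4 := by
      rw [div_le_iff₀ hsm]
      linarith
    linarith
  have hmmu : ∀ a, m * mu a = 4 * a * √m := by
    intro a
    have : mu a * √m = 4 * a := div_mul_cancel₀ _ hsm.ne'
    linear_combination √m * this - mu a * hss
  let E : ℕ → Finset (Fin m → ℤˣ) := fun a =>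
    Finset.univ.filter fun y => |∑ j, ((y j : ℤ) : ℝ) - m * mu a| < 2 * √m
  have hdisj : ∀ y : Fin m → ℤˣ, ∀ a a', y ∈ E a → y ∈ E a' → a = a' := by
    have haux : ∀ y : Fin m → ℤˣ, ∀ a a', y ∈ E a → y ∈ E a' → ¬ a < a' := by
      intro y a a' h h' hlt
      have h1 := abs_lt.1 (Finset.mem_filter.1 h).2
      have h2 := abs_lt.1 (Finset.mem_filter.1 h').2
      rw [hmmu] at h1 h2
      have : (a : ℝ) + 1 ≤ a' := by exact_mod_cast hlt
      nlinarith [mul_le_mul_of_nonneg_right this hsm.le]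
    intro y a a' h h'
    rcases lt_trichotomy a a' with hlt | heq | hlt
    · exact absurd hlt (haux y a a' h h')
    · exact heq
    · exact absurd hlt (haux y a' a h' h)
  have hmixed : ∀ a ≤ N, ∀ y ∈ E a, Mixed y := by
    intro a ha y hy
    have h1 := abs_lt.1 (Finset.mem_filter.1 hy).2
    have h2 := hmub a ha
    have h3 : (m : ℝ) * mu a ≤ m / 4 := by nlinarith [hmu0 a]
    have h4 : 0 ≤ (m : ℝ) * mu a := mul_nonneg (by linarith) (hmu0 a)
    have h5 : 8 / 3 < √(m : ℝ) := Real.lt_sqrt_of_sq_lt (by norm_num; linarith)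
    have h6 : 2 * √(m : ℝ) < 3 / 4 * m := by nlinarith
    exact mixed_of_sum_lt (by linarith) (by linarith)
  let g : (Fin m → ℤˣ) → ℝ := fun y =>
    if h : ∃ a, a ≤ N ∧ y ∈ E a then meanParam (mu h.choose) else 0
  have hg : ∀ a ≤ N, ∀ y ∈ E a, g y = meanParam (mu a) := by
    intro a ha y hy
    have h : ∃ a, a ≤ N ∧ y ∈ E a := ⟨a, ha, hy⟩
    simp only [g, dif_pos h]
    rw [hdisj y _ _ h.choose_spec.2 hy]
  refine ⟨g, fun y => ?_, ?_⟩
  · by_cases h : ∃ a, a ≤ N ∧ y ∈ E a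
    · obtain ⟨a, ha, hy⟩ := h
      rw [hg a ha y hy]
      exact meanParam_mem (hmu0 a) (hmub a ha) hb1
    · simp only [g, dif_neg h]
      exact ⟨le_rfl, hb0.le⟩
  · calc 3 / 64 * b * √m ≤ ∑ a ∈ Finset.range (N + 1), (3 / 4 : ℝ) := by
          simp only [Finset.sum_const, Finset.card_range, nsmul_eq_mul]
          push_cast
          linarith
      _ ≤ ∑ a ∈ Finset.range (N + 1), ∑ y ∈ E a,
            ∏ j, Real.sigmoid (((y j : ℤ) : ℝ) * g y) := by
          refine Finset.sum_le_sum fun a ha => ?_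
          have ha' : a ≤ N := Nat.lt_succ_iff.1 (Finset.mem_range.1 ha)
          have h1 : mu a < 1 := by linarith [hmub a ha', hmu0 a]
          refine (three_quarters_le_sum_near_mean (sigmoid_meanParam (hmu0 a) h1)
            (by omega : 0 < m)).trans (le_of_eq ?_)
          exact Finset.sum_congr rfl fun y hy => by rw [hg a ha' y hy]
      _ = ∑ y ∈ (Finset.range (N + 1)).biUnion E,
            ∏ j, Real.sigmoid (((y j : ℤ) : ℝ) * g y) := by
          refine (Finset.sum_biUnion fun a _ a' _ hne => ?_).symm
          exact Finset.disjoint_left.2 fun y hy hy' => hne (hdisj y a a' hy hy')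
      _ ≤ _ := by
          refine Finset.sum_le_sum_of_subset_of_nonneg (fun y hy => ?_)
            fun y _ _ => Finset.prod_nonneg fun j _ => (Real.sigmoid_pos _).le
          obtain ⟨a, ha, hy⟩ := Finset.mem_biUnion.1 hy
          exact Finset.mem_filter.2 ⟨Finset.mem_univ _,
            hmixed a (Nat.lt_succ_iff.1 (Finset.mem_range.1 ha)) y hy⟩

/-- The one-parameter problem without offsets, with a parameter in an interval of length at
most `1`. -/
theorem shtarkovSumGE_zero {m : ℕ} (hm : 8 ≤ m) {b : ℝ} (hb0 : 0 < b) (hb1 : b ≤ 1) :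
    ShtarkovSumGE (fun _ : Fin m => 0) (Set.Icc 0 b) (3 / 64 * b * √m) := by
  classical
  obtain ⟨g, hg, hsum⟩ := exists_le_sum_mixed hm hb0 hb1
  refine ⟨g, hg, hsum.trans ?_⟩
  simp only [sub_zero]
  exact Finset.sum_le_sum_of_subset_of_nonneg (Finset.filter_subset _ _)
    fun y _ _ => Finset.prod_nonneg fun j _ => (Real.sigmoid_pos _).le

/-- Labels `1` in the blocks before block `i`, the labels `w` in block `i`, and labels `-1` in the
later blocks. -/
def stepLabels {K m : ℕ} (i : Fin K) (w : Fin m → ℤˣ) : Fin K × Fin m → ℤˣ := fun p =>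
  if p.1 < i then 1 else if p.1 = i then w p.2 else -1

theorem stepLabels_injective {K m : ℕ} {i i' : Fin K} {w w' : Fin m → ℤˣ} (hw : Mixed w)
    (hw' : Mixed w') (h : stepLabels i w = stepLabels i' w') : i = i' ∧ w = w' := by
  have haux : ∀ {i i' : Fin K} {w w' : Fin m → ℤˣ}, Mixed w →
      stepLabels i w = stepLabels i' w' → ¬ i < i' := by
    intro i i' w w' hw h hlt
    obtain ⟨j, hj⟩ := hw.2
    have := congrFun h (i, j)
    simp [stepLabels, hlt, hj] at this
  have hi : i = i' := le_antisymm (not_lt.1 (haux hw' h.symm)) (not_lt.1 (haux hw h))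
  subst hi
  refine ⟨rfl, funext fun j => ?_⟩
  simpa [stepLabels] using congrFun h (i, j)

/-- If `n` labels each have probability at least `1 - 1 / (2 n)`, all occur with probability at
least `1 / 2`. -/
theorem half_le_sigmoid_pow {n : ℕ} {v : ℝ} (hv : Real.log (2 * n) ≤ v) :
    1 / 2 ≤ Real.sigmoid v ^ n := by
  rcases Nat.eq_zero_or_pos n with rfl | hn
  · norm_num
  have hn' : (0 : ℝ) < n := by exact_mod_cast hn
  have h1 : 2 * (n : ℝ) ≤ Real.exp v :=
    (Real.log_le_iff_le_exp (by positivity)).1 hv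
  have h2 : n * (1 - Real.sigmoid v) ≤ 1 / 2 := by
    have h3 : 1 - Real.sigmoid v ≤ (Real.exp v)⁻¹ := by
      rw [← Real.sigmoid_neg, Real.sigmoid, neg_neg]
      exact inv_anti₀ (Real.exp_pos _) (by linarith)
    have h4 : (Real.exp v)⁻¹ ≤ (2 * (n : ℝ))⁻¹ := inv_anti₀ (by positivity) h1
    calc n * (1 - Real.sigmoid v) ≤ n * (2 * (n : ℝ))⁻¹ :=
          mul_le_mul_of_nonneg_left (h3.trans h4) hn'.le
      _ = 1 / 2 := by field_simp
  have h5 := one_add_mul_le_pow (a := Real.sigmoid v - 1)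
    (by linarith [Real.sigmoid_pos v]) n
  rw [add_sub_cancel] at h5
  linarith

open Classical in
/-- The one-parameter problem with `K` well separated offsets, `m` rounds each: the labels show
which offset the parameter is close to, so that the sums for the single offsets add up. -/
theorem shtarkovSumGE_offsets {K m : ℕ} (hm : 8 ≤ m) {L : ℝ}
    (hL : 1 + Real.log (2 * (K * m : ℕ)) ≤ L) (hL1 : 1 ≤ L) (hK : 0 < K) :
    ShtarkovSumGE (fun p : Fin K × Fin m => (p.1 : ℝ) * L) (Set.Icc 0 (K * L))
      (3 / 128 * K * √m) := by
  obtain ⟨g, hg, hsum⟩ := exists_le_sum_mixed hm one_pos le_rfl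
  have hUmem : ∀ (i : Fin K) (w : Fin m → ℤˣ), (i : ℝ) * L + g w ∈ Set.Icc 0 (K * L) := by
    intro i w
    have h1 := hg w
    have h2 : (i : ℝ) + 1 ≤ K := by exact_mod_cast i.isLt
    have h3 := mul_le_mul_of_nonneg_right h2 (by linarith : (0 : ℝ) ≤ L)
    exact ⟨by have := h1.1; positivity, by linarith [h1.2]⟩
  let φ : Fin K × {w : Fin m → ℤˣ // Mixed w} → (Fin K × Fin m → ℤˣ) := fun q =>
    stepLabels q.1 q.2.1
  have hφ : Function.Injective φ := by
    rintro ⟨i, w, hw⟩ ⟨i', w', hw'⟩ h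
    obtain ⟨rfl, rfl⟩ := stepLabels_injective hw hw' h
    rfl
  let G : (Fin K × Fin m → ℤˣ) → ℝ :=
    Function.extend φ (fun q => (q.1 : ℝ) * L + g q.2.1) (fun _ => 0)
  have hG : ∀ q, G (φ q) = (q.1 : ℝ) * L + g q.2.1 := fun q => hφ.extend_apply _ _ q
  refine ⟨G, fun y => ?_, ?_⟩
  · by_cases h : ∃ q, φ q = y
    · obtain ⟨q, rfl⟩ := h
      rw [hG]
      exact hUmem _ _
    · simp only [G, Function.extend_apply' _ _ _ h]
      exact ⟨le_rfl, by positivity⟩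
  have hterm : ∀ q : Fin K × {w : Fin m → ℤˣ // Mixed w},
      1 / 2 * ∏ j, Real.sigmoid (((q.2.1 j : ℤ) : ℝ) * g q.2.1)
      ≤ ∏ p, Real.sigmoid (((φ q p : ℤ) : ℝ) * (G (φ q) - (p.1 : ℝ) * L)) := by
    intro q
    rw [hG, Fintype.prod_prod_type, ← Finset.mul_prod_erase _ _ (Finset.mem_univ q.1), mul_comm]
    refine mul_le_mul (le_of_eq ?_) ?_ (by norm_num)
      (Finset.prod_nonneg fun j _ => (Real.sigmoid_pos _).le)
    · refine Finset.prod_congr rfl fun j _ => ?_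
      simp [φ, stepLabels]
    -- Outside block `q.1` every label has a margin of at least `L - 1`.
    · have hfar : ∀ i ∈ Finset.univ.erase q.1, ∀ j : Fin m, Real.sigmoid (L - 1) ≤
          Real.sigmoid (((φ q (i, j) : ℤ) : ℝ) * ((q.1 : ℝ) * L + g q.2.1 - (i : ℝ) * L)) := by
        intro i hi j
        apply Real.sigmoid_monotone
        have hne := Finset.ne_of_mem_erase hi
        have hg0 := hg q.2.1
        rcases lt_or_gt_of_ne hne with hlt | hgt
        · have h2 : (i : ℝ) + 1 ≤ q.1 := by exact_mod_cast hlt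
          have h3 := mul_le_mul_of_nonneg_right h2 (by linarith : (0 : ℝ) ≤ L)
          simp [φ, stepLabels, hlt]
          linarith [hg0.1]
        · have h2 : (q.1 : ℝ) + 1 ≤ i := by exact_mod_cast hgt
          have h3 := mul_le_mul_of_nonneg_right h2 (by linarith : (0 : ℝ) ≤ L)
          simp [φ, stepLabels, hne, not_lt.2 hgt.le]
          linarith [hg0.2]
      have hpow := half_le_sigmoid_pow (n := K * m) (v := L - 1) (by linarith)
      calc (1 / 2 : ℝ) ≤ Real.sigmoid (L - 1) ^ (K * m) := hpow
        _ ≤ Real.sigmoid (L - 1) ^ ((K - 1) * m) :=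
            pow_le_pow_of_le_one (Real.sigmoid_pos _).le (Real.sigmoid_lt_one _).le
              (Nat.mul_le_mul_right _ (Nat.sub_le _ _))
        _ = ∏ i ∈ Finset.univ.erase q.1, ∏ j : Fin m, Real.sigmoid (L - 1) := by
            simp [Finset.card_erase_of_mem, ← pow_mul, mul_comm]
        _ ≤ _ := Finset.prod_le_prod
            (fun i _ => Finset.prod_nonneg fun j _ => (Real.sigmoid_pos _).le)
            fun i hi => Finset.prod_le_prod (fun j _ => (Real.sigmoid_pos _).le)
              fun j _ => hfar i hi j
  calc 3 / 128 * K * √m = ∑ i : Fin K, 1 / 2 * (3 / 64 * 1 * √(m : ℝ)) := by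
        simp; ring
    _ ≤ ∑ i : Fin K, 1 / 2 * ∑ w : {w : Fin m → ℤˣ // Mixed w},
          ∏ j, Real.sigmoid (((w.1 j : ℤ) : ℝ) * g w.1) := by
        refine Finset.sum_le_sum fun i _ => mul_le_mul_of_nonneg_left ?_ (by norm_num)
        refine hsum.trans (le_of_eq ?_)
        exact Finset.sum_subtype _ (by simp) _
    _ = ∑ q : Fin K × {w : Fin m → ℤˣ // Mixed w},
          1 / 2 * ∏ j, Real.sigmoid (((q.2.1 j : ℤ) : ℝ) * g q.2.1) := by
        rw [Fintype.sum_prod_type]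
        simp_rw [Finset.mul_sum]
    _ ≤ ∑ q : Fin K × {w : Fin m → ℤˣ // Mixed w},
          ∏ p, Real.sigmoid (((φ q p : ℤ) : ℝ) * (G (φ q) - (p.1 : ℝ) * L)) :=
        Finset.sum_le_sum fun q _ => hterm q
    _ = ∑ y ∈ Finset.univ.image φ,
          ∏ p, Real.sigmoid (((y p : ℤ) : ℝ) * (G y - (p.1 : ℝ) * L)) := by
        rw [Finset.sum_image fun q _ q' _ h => hφ h]
    _ ≤ _ := Finset.sum_le_sum_of_subset_of_nonneg (Finset.subset_univ _)
        fun y _ _ => Finset.prod_nonneg fun p _ => (Real.sigmoid_pos _).le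

/-! ### Boxes inside the comparator class -/

/-- A vector with at most `n` nonzero coordinates, all at most `b` in absolute value, has
`ℓ^ρ` norm at most `b * n ^ (κ / 2)`; here `κ = 2 / ρ`. -/
def BoxBound (ρ : ℝ≥0∞) (κ : ℕ) : Prop :=
  ∀ (d : ℕ) (θ : Vec d) (b : ℝ) (s : Finset (Fin d)), 0 ≤ b → (∀ i ∈ s, |θ i| ≤ b) →
    (∀ i ∉ s, θ i = 0) → ‖WithLp.toLp ρ θ‖ ≤ b * √((s.card : ℝ) ^ κ)

theorem boxBound_one : BoxBound 1 2 := by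
  intro d θ b s hb hs h0
  have h : ‖WithLp.toLp 1 θ‖ = ∑ i, |θ i| := by
    rw [PiLp.norm_eq_of_nat 1 (by norm_num)]
    simp
  rw [h, Real.sqrt_sq (Nat.cast_nonneg _), ← Finset.sum_subset (Finset.subset_univ s)
    (fun i _ hi => by rw [h0 i hi, abs_zero]), mul_comm, ← nsmul_eq_mul]
  exact Finset.sum_le_card_nsmul _ _ _ hs

theorem boxBound_two : BoxBound 2 1 := by
  intro d θ b s hb hs h0
  have h : ‖WithLp.toLp 2 θ‖ = √(∑ i, θ i ^ 2) := by
    rw [EuclideanSpace.norm_eq]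
    simp
  rw [h, pow_one, Real.sqrt_le_left (by positivity), mul_pow, Real.sq_sqrt (Nat.cast_nonneg _),
    ← Finset.sum_subset (Finset.subset_univ s)
    (fun i _ hi => by rw [h0 i hi, zero_pow two_ne_zero]), mul_comm, ← nsmul_eq_mul]
  refine Finset.sum_le_card_nsmul _ _ _ fun i hi => ?_
  rw [← sq_abs]
  exact pow_le_pow_left₀ (abs_nonneg _) (hs i hi) 2

theorem boxBound_top : BoxBound ∞ 0 := by
  intro d θ b s hb hs h0
  rw [PiLp.norm_eq_ciSup, pow_zero, Real.sqrt_one, mul_one]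
  refine Real.iSup_le (fun i => ?_) hb
  by_cases hi : i ∈ s
  · exact hs i hi
  · simp [h0 i hi, hb]

/-! ### Forced regret for explicit designs -/

/-- `k` coordinates, each ranging over `[0, b]` with `b ≤ 1` and observed on its own in `T / k`
rounds. -/
theorem regretForced_small_box {ρ : ℝ≥0∞} {κ : ℕ} (hρ : BoxBound ρ κ) {T d k : ℕ} {B b : ℝ}
    (hk : 1 ≤ k) (hkd : k ≤ d) (hkT : 8 * k ≤ T) (hb0 : 0 < b) (hb1 : b ≤ 1)
    (hbB : b * √((k : ℝ) ^ κ) ≤ B) :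
    RegretForced ρ T d B
      (k * (Real.log b + Real.log (T / k) / 2 - Real.log 64)) := by
  have hk' : (0 : ℝ) < k := by exact_mod_cast hk
  have hT' : (0 : ℝ) < T := by exact_mod_cast (by omega : 0 < T)
  set m : ℕ := T / k with hm
  have hm8 : 8 ≤ m := (Nat.le_div_iff_mul_le hk).2 hkT
  have hmT : (T : ℝ) / k ≤ 2 * m := by
    rw [div_le_iff₀ hk']
    have h1 : T < k * (m + 1) := Nat.lt_mul_div_succ T hk
    have h2 : k * (m + 1) ≤ 2 * m * k := by nlinarith
    exact_mod_cast (h1.le.trans h2)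
  have hS := shtarkovSumGE_zero hm8 hb0 hb1
  have hZ : 0 < 3 / 64 * b * √(m : ℝ) := by
    have : 0 < √(m : ℝ) := Real.sqrt_pos.2 (by exact_mod_cast (by omega : 0 < m))
    positivity
  have hsupp : (Finset.univ.image (Fin.castLE hkd)).card = k := by
    rw [Finset.card_image_of_injective _ (Fin.castLE_injective hkd)]
    simp
  have hreg := regretForced_of_shtarkovSumGE (T := T) (B := B) (ρ := ρ) hZ hS
    (fun u : Fin k → ℝ => fun i : Fin d => if h : (i : ℕ) < k then u ⟨i, h⟩ else 0)
    (fun p => Pi.single (Fin.castLE hkd p.1) 1) ?_ ?_ ?_ ?_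
  · refine hreg.mono (mul_le_mul_of_nonneg_left ?_ hk'.le)
    have h1 : Real.log b + Real.log (T / k) / 2 - Real.log 64 = Real.log (b * √(T / k) / 64) := by
      rw [Real.log_div (y := 64) (by positivity) (by norm_num),
        Real.log_mul hb0.ne' (by positivity), Real.log_sqrt (by positivity)]
    rw [h1]
    refine Real.log_le_log (by positivity) ?_
    have h2 : √((T : ℝ) / k) ≤ 3 * √m := by
      rw [Real.sqrt_le_left (by positivity), mul_pow, Real.sq_sqrt (Nat.cast_nonneg _)]
      linarith [(Nat.cast_nonneg m : (0 : ℝ) ≤ m)]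
    nlinarith [mul_le_mul_of_nonneg_left h2 hb0.le]
  · intro p i
    by_cases h : i = Fin.castLE hkd p.1
    · subst h; simp
    · simp [h]
  · intro u p
    rw [Finset.sum_eq_single (Fin.castLE hkd p.1) (fun i _ hi => by simp [hi]) (by simp)]
    simp
  · intro u hu
    refine (hρ d _ b (Finset.univ.image (Fin.castLE hkd)) hb0.le ?_ ?_).trans ?_
    · intro i _
      by_cases h : (i : ℕ) < k
      · simp only [dif_pos h]
        exact abs_le.2 ⟨by linarith [(hu ⟨i, h⟩).1], (hu _).2⟩
      · simp [h, hb0.le]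
    · intro i hi
      have h : ¬ (i : ℕ) < k := fun h => hi (Finset.mem_image.2 ⟨⟨i, h⟩, Finset.mem_univ _, rfl⟩)
      simp [h]
    · rw [hsupp]; exact hbB
  · rw [Fintype.card_fin]
    exact Nat.mul_div_le T k

/-- One coordinate is fixed at `K * L` and serves as a reference; each of the other `d - 1`
coordinates is compared with the `K` multiples `0, L, 2 L, …` of `L` below it. -/
theorem regretForced_reference {ρ : ℝ≥0∞} {κ : ℕ} (hρ : BoxBound ρ κ) {T n K : ℕ} {B L : ℝ}
    (hn : 1 ≤ n) (hK : 1 ≤ K) (hT : 8 * (n * K) ≤ T) (hL : 1 + Real.log (2 * T) ≤ L)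
    (hB : K * L * √(((n + 1 : ℕ) : ℝ) ^ κ) ≤ B) :
    RegretForced ρ T (n + 1) B
      (n * (Real.log (K * T / n) / 2 - Real.log 64)) := by
  have hn' : (0 : ℝ) < n := by exact_mod_cast hn
  have hK' : (0 : ℝ) < K := by exact_mod_cast hK
  have hnK : 0 < n * K := Nat.mul_pos hn hK
  have hT1 : 1 ≤ T := by omega
  have hT' : (1 : ℝ) ≤ T := by exact_mod_cast hT1
  have hL1 : 1 ≤ L := by linarith [Real.log_nonneg (by linarith : (1 : ℝ) ≤ 2 * T)]
  have hKL : 0 < K * L := by positivity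
  set m : ℕ := T / (n * K) with hm
  have hm8 : 8 ≤ m := (Nat.le_div_iff_mul_le hnK).2 hT
  have hmT : (T : ℝ) / (n * K) ≤ 2 * m := by
    rw [div_le_iff₀ (by positivity)]
    have h1 : T < n * K * (m + 1) := Nat.lt_mul_div_succ T hnK
    have h2 : n * K * (m + 1) ≤ 2 * m * (n * K) := by nlinarith
    exact_mod_cast (h1.le.trans h2)
  have hnKm : n * (K * m) ≤ T := by
    rw [← mul_assoc]
    exact Nat.mul_div_le T (n * K)
  have hKm : ((K * m : ℕ) : ℝ) ≤ T := by
    exact_mod_cast (Nat.le_mul_of_pos_left _ hn).trans hnKm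
  have hKmpos : (0 : ℝ) < ((K * m : ℕ) : ℝ) := by
    exact_mod_cast Nat.mul_pos hK (by omega : 0 < m)
  have hS := shtarkovSumGE_offsets (K := K) hm8 (L := L)
    (by linarith [Real.log_le_log (by positivity) (mul_le_mul_of_nonneg_left hKm zero_le_two)])
    hL1 hK
  have hsm : 0 < √(m : ℝ) := Real.sqrt_pos.2 (by exact_mod_cast (by omega : 0 < m))
  have hZ : 0 < 3 / 128 * (K : ℝ) * √(m : ℝ) := by positivity
  have hfrac : ∀ j : Fin K, |(j : ℝ) * L / (K * L)| ≤ 1 := by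
    intro j
    have : (j : ℝ) ≤ K := by exact_mod_cast j.isLt.le
    rw [abs_of_nonneg (by positivity), div_le_one hKL]
    exact mul_le_mul_of_nonneg_right this (by linarith)
  have hreg := regretForced_of_shtarkovSumGE (T := T) (B := B) (ρ := ρ) hZ hS
    (fun u : Fin n → ℝ => (Fin.cons (K * L) u : Vec (n + 1)))
    (fun p => (Fin.cons (-((p.2.1 : ℝ) * L / (K * L))) (Pi.single p.1 1) : Vec (n + 1))) ?_ ?_ ?_ ?_
  · refine hreg.mono (mul_le_mul_of_nonneg_left ?_ hn'.le)
    have h1 : Real.log (K * T / n) / 2 - Real.log 64 = Real.log (√(K * T / n) / 64) := by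
      rw [Real.log_div (y := 64) (by positivity) (by norm_num), Real.log_sqrt (by positivity)]
    rw [h1]
    refine Real.log_le_log (by positivity) ?_
    have h2 : √((K : ℝ) * T / n) ≤ 3 / 2 * (K * √m) := by
      rw [Real.sqrt_le_left (by positivity), mul_pow, mul_pow, Real.sq_sqrt (Nat.cast_nonneg _)]
      have h3 : (K : ℝ) * T / n = K ^ 2 * (T / (n * K)) := by field_simp
      rw [h3]
      nlinarith [mul_le_mul_of_nonneg_left hmT (sq_nonneg (K : ℝ)),
        mul_nonneg (sq_nonneg (K : ℝ)) (Nat.cast_nonneg m : (0 : ℝ) ≤ m)]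
    have h4 : 0 < (K : ℝ) * √m := by positivity
    nlinarith
  · intro p i
    refine Fin.cases ?_ (fun i => ?_) i
    · rw [Fin.cons_zero, abs_neg]
      exact hfrac _
    · rw [Fin.cons_succ]
      by_cases h : i = p.1
      · subst h; simp
      · simp [h]
  · intro u p
    rw [Fin.sum_univ_succ]
    simp only [Fin.cons_zero, Fin.cons_succ, Pi.single_apply, ite_mul, one_mul, zero_mul,
      Finset.sum_ite_eq', Finset.mem_univ, if_true]
    field_simp
    ring
  · intro u hu
    refine (hρ (n + 1) _ (K * L) Finset.univ hKL.le ?_ ?_).trans ?_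
    · intro i _
      refine Fin.cases ?_ (fun i => ?_) i
      · simp only [Fin.cons_zero]
        exact (abs_of_pos hKL).le
      · simp only [Fin.cons_succ]
        exact abs_le.2 ⟨by linarith [(hu i).1], (hu i).2⟩
    · intro i hi
      exact absurd (Finset.mem_univ i) hi
    · rw [Finset.card_univ, Fintype.card_fin]; exact hB
  · rw [Fintype.card_prod, Fintype.card_fin, Fintype.card_fin]
    exact hnKm

/-! ### Asymptotics -/

theorem eventually_le_mul_log {a : ℝ} (ha : 0 < a) (c : ℝ) :
    ∀ᶠ T : ℕ in atTop, c ≤ a * Real.log T :=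
  ((Real.tendsto_log_atTop.comp tendsto_natCast_atTop_atTop).const_mul_atTop ha).eventually_ge_atTop
    c

theorem log_natCast_rpow {T : ℕ} (hT : 0 < T) (a : ℝ) :
    Real.log ((T : ℝ) ^ a) = a * Real.log T :=
  Real.log_rpow (by exact_mod_cast hT) a

theorem effGamma_pos {ε B : ℝ} {T d : ℕ} (hT : 0 < Real.log T) (hd : 1 ≤ d) (hB : 0 < B) :
    0 < effGamma ε T d B := by
  have hT0 : (0 : ℝ) < T := by
    rcases Nat.eq_zero_or_pos T with rfl | h
    · simp at hT
    · exact_mod_cast h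
  have hd' : (0 : ℝ) < d := by exact_mod_cast hd
  have hQ : 0 < (T : ℝ) ^ (1 - ε) := Real.rpow_pos_of_pos hT0 _
  exact lt_min (div_pos hB hT) (div_pos hQ (lt_min hQ hd'))

theorem effGamma_mul_log_le {ε B : ℝ} {T d : ℕ} (hT : 0 < Real.log T) :
    effGamma ε T d B * Real.log T ≤ B :=
  (le_div_iff₀ hT).1 (min_le_left _ _)

theorem effGamma_mul_min_le {ε B : ℝ} {T d : ℕ} (hT : 0 < T) (hd : 1 ≤ d) :
    effGamma ε T d B * min ((T : ℝ) ^ (1 - ε)) d ≤ (T : ℝ) ^ (1 - ε) := by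
  have hd' : (0 : ℝ) < d := by exact_mod_cast hd
  have hQ : 0 < (T : ℝ) ^ (1 - ε) := Real.rpow_pos_of_pos (by exact_mod_cast hT) _
  exact (le_div_iff₀ (lt_min hQ hd')).1 (min_le_right _ _)

/-- `regretForced_small_box` for the largest box of side at most `1` that the comparator class
contains. -/
theorem regretForced_of_log_le {ρ : ℝ≥0∞} {κ : ℕ} (hρ : BoxBound ρ κ) {T d k : ℕ} {B M : ℝ}
    (hk : 1 ≤ k) (hkd : k ≤ d) (hkT : 8 * k ≤ T) (hB : 0 < B)
    (h1 : 2 * M ≤ Real.log T - Real.log k)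
    (h2 : 2 * M ≤ 2 * Real.log B + Real.log T - (κ + 1) * Real.log k) :
    RegretForced ρ T d B (k * (M - Real.log 64)) := by
  have hk' : (0 : ℝ) < k := by exact_mod_cast hk
  have hT' : (0 : ℝ) < T := by exact_mod_cast (by omega : 0 < T)
  have hs : 0 < √((k : ℝ) ^ κ) := Real.sqrt_pos.2 (by positivity)
  have hlT : Real.log (T / k) = Real.log T - Real.log k := Real.log_div hT'.ne' hk'.ne'
  have hreg := regretForced_small_box hρ (B := B) (b := min 1 (B / √((k : ℝ) ^ κ))) hk hkd hkT
    (lt_min one_pos (by positivity)) (min_le_left _ _)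
    ((le_div_iff₀ hs).1 (min_le_right _ _))
  refine hreg.mono (mul_le_mul_of_nonneg_left ?_ hk'.le)
  rw [hlT]
  rcases min_choice 1 (B / √((k : ℝ) ^ κ)) with h | h <;> rw [h]
  · rw [Real.log_one]
    linarith
  · rw [Real.log_div hB.ne' hs.ne', Real.log_sqrt (by positivity), Real.log_pow]
    linarith

/-- In bounded dimension a box of side `T ^ (-δ)`, up to a constant, is available, and its
smallness costs only `δ log T` in each coordinate. -/
theorem regretForced_bounded_dim {ρ : ℝ≥0∞} {κ : ℕ} (hρ : BoxBound ρ κ) {η θ δ : ℝ}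
    (hθη : θ ≤ η) (hθ : 0 < θ) (hθ1 : θ ≤ 1) (hδ : 4 * δ ≤ θ) (D : ℕ) :
    ∀ᶠ T : ℕ in atTop, ∀ d : ℕ, 1 ≤ d → d ≤ D → ∀ B : ℝ, (T : ℝ) ^ (-δ) ≤ B →
      RegretForced ρ T d B ((1 - η) * ((d : ℝ) / 2 * Real.log ((T : ℝ) / d))) := by
  filter_upwards [eventually_le_mul_log (a := θ / 2) (by positivity)
    (2 * Real.log 64 + (κ + 1) * Real.log D), eventually_ge_atTop (8 * D), eventually_gt_atTop 0]
    with T hT1 hT8 hT0 d hd hdD B hB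
  have hd' : (0 : ℝ) < d := by exact_mod_cast hd
  have hT' : (0 : ℝ) < T := by exact_mod_cast hT0
  have hdT : (d : ℝ) ≤ T := by exact_mod_cast (by omega : d ≤ T)
  have hld : Real.log d ≤ Real.log D := Real.log_le_log hd' (by exact_mod_cast hdD)
  have hld0 : 0 ≤ Real.log d := Real.log_natCast_nonneg d
  have hlT0 : 0 ≤ Real.log T := Real.log_natCast_nonneg T
  have hB0 : 0 < B := (Real.rpow_pos_of_pos hT' _).trans_le hB
  have hlB : -δ * Real.log T ≤ Real.log B := by
    rw [← log_natCast_rpow hT0]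
    exact Real.log_le_log (Real.rpow_pos_of_pos hT' _) hB
  have hlk : ((κ : ℝ) + 1) * Real.log d ≤ (κ + 1) * Real.log D :=
    mul_le_mul_of_nonneg_left hld (by positivity)
  have hδT : 4 * δ * Real.log T ≤ θ * Real.log T := mul_le_mul_of_nonneg_right hδ hlT0
  have hκd : Real.log d ≤ ((κ : ℝ) + 1) * Real.log D := by
    have : (0 : ℝ) ≤ κ * Real.log d := by positivity
    linarith
  have hreg := regretForced_of_log_le hρ (T := T) (B := B)
    (M := (Real.log T - θ / 2 * Real.log T - (κ + 1) * Real.log D) / 2) hd le_rfl (by omega) hB0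
    (by have := mul_nonneg hθ.le hlT0; linarith) (by linarith)
  refine hreg.mono ?_
  rw [Real.log_div hT'.ne' hd'.ne']
  have hnn : 0 ≤ Real.log T - Real.log d := sub_nonneg.2 (Real.log_le_log hd' hdT)
  have h1 : (1 - η) * (Real.log T - Real.log d) ≤ (1 - θ) * (Real.log T - Real.log d) :=
    mul_le_mul_of_nonneg_right (by linarith) hnn
  have h2 : (1 - θ) * (Real.log T - Real.log d) ≤ (1 - θ) * Real.log T :=
    mul_le_mul_of_nonneg_left (by linarith) (by linarith)
  have h3 := mul_le_mul_of_nonneg_left (show (1 - η) * (Real.log T - Real.log d) / 2 ≤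
    (Real.log T - θ / 2 * Real.log T - (κ + 1) * Real.log D) / 2 - Real.log 64 by linarith) hd'.le
  linarith

/-- The three logarithmic regret bounds below the critical dimension. If `γ / d ^ κ ≤ T ^ δ`,
a box of side at most `1` suffices; otherwise the reference coordinate is used, at the cost of one
of the `d ≥ 4 / θ` dimensions. -/
theorem regretForced_below {ρ : ℝ≥0∞} {κ : ℕ} (hρ : BoxBound ρ κ) {ε η θ δ C C' : ℝ}
    (hε : 0 < ε) (hθη : θ ≤ η) (hθ : 0 < θ) (hθ1 : θ ≤ 1) (hδ0 : 0 < δ) (hδ : 4 * δ ≤ θ * ε)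
    (hC : 0 < C) (hC' : 0 < C') :
    ∀ᶠ T : ℕ in atTop, ∀ d : ℕ, 1 ≤ d → ∀ B : ℝ, (T : ℝ) ^ (-δ) ≤ B →
      (4 / θ ≤ d ∨ effGamma ε T d B ≤ (T : ℝ) ^ δ) →
      (d : ℝ) ^ (κ + 1) < C * effGamma ε T d B * (T : ℝ) ^ (1 - ε) →
      RegretForced ρ T d B ((1 - η) * ((d : ℝ) / 2 *
        Real.log (C' * effGamma ε T d B * T / (d : ℝ) ^ (κ + 1)))) := by
  have hθε : 0 < θ * ε := mul_pos hθ hε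
  filter_upwards [eventually_le_mul_log (a := 1) one_pos 1,
    eventually_le_mul_log (a := 3 / 4 * ε) (by positivity) (Real.log C + Real.log 8),
    eventually_le_mul_log (a := 3 / 4 * (θ * ε)) (by positivity)
      (|Real.log C| + 2 * Real.log 64 + Real.log 6 + |Real.log C'|),
    eventually_le_mul_log hε (|Real.log C| + |Real.log C'|),
    eventually_le_mul_log hδ0 (Real.log 3), eventually_le_mul_log hε (Real.log 3),
    eventually_gt_atTop 0]
    with T hl1 hT8 hTbig hTpos hT3 hTε hT0 d hd B hB hbig hsmall
  have hd' : (0 : ℝ) < d := by exact_mod_cast hd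
  have hd1 : (1 : ℝ) ≤ d := by exact_mod_cast hd
  have hT' : (0 : ℝ) < T := by exact_mod_cast hT0
  rw [one_mul] at hl1
  have hl0 : 0 < Real.log T := by linarith
  have hB0 : 0 < B := (Real.rpow_pos_of_pos hT' _).trans_le hB
  have hγ0 := effGamma_pos (ε := ε) hl0 hd hB0
  have hγB := effGamma_mul_log_le (ε := ε) (d := d) (B := B) hl0
  have hγd := effGamma_mul_min_le (ε := ε) (B := B) hT0 hd
  set γ := effGamma ε T d B with hγ
  set ℓ := Real.log T with hℓ
  set X := Real.log γ + ℓ - (κ + 1) * Real.log d with hX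
  have hQ : 0 < (T : ℝ) ^ (1 - ε) := Real.rpow_pos_of_pos hT' _
  have hlQ : Real.log ((T : ℝ) ^ (1 - ε)) = (1 - ε) * ℓ := log_natCast_rpow hT0 _
  have hld0 : 0 ≤ Real.log d := Real.log_natCast_nonneg d
  have hlB : -δ * ℓ ≤ Real.log B := by
    rw [← log_natCast_rpow hT0]
    exact Real.log_le_log (Real.rpow_pos_of_pos hT' _) hB
  have hγB' : γ ≤ B := (le_mul_of_one_le_right hγ0.le hl1).trans hγB
  have hlγB : Real.log γ ≤ Real.log B := Real.log_le_log hγ0 hγB'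
  have htarget : Real.log (C' * γ * T / (d : ℝ) ^ (κ + 1)) = Real.log C' + X := by
    rw [Real.log_div (by positivity) (by positivity), Real.log_mul (by positivity) hT'.ne',
      Real.log_mul hC'.ne' hγ0.ne', Real.log_pow]
    push_cast
    ring
  have hsmall' : (κ + 1) * Real.log d ≤ Real.log C + Real.log γ + (1 - ε) * ℓ := by
    have h := Real.log_le_log (by positivity) hsmall.le
    rw [Real.log_mul (by positivity) hQ.ne', Real.log_mul hC.ne' hγ0.ne', Real.log_pow, hlQ] at h
    push_cast at h
    exact h
  have hXlow : ε * ℓ - |Real.log C| ≤ X := by linarith [le_abs_self (Real.log C)]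
  have hθX : θ * ε * ℓ - |Real.log C| ≤ θ * X := by
    have h1 := mul_le_mul_of_nonneg_left hXlow hθ.le
    have h2 := mul_le_mul_of_nonneg_right hθ1 (abs_nonneg (Real.log C))
    linarith
  have hδℓ : 4 * δ * ℓ ≤ θ * ε * ℓ := mul_le_mul_of_nonneg_right hδ hl0.le
  have hδε : δ * ℓ ≤ ε / 4 * ℓ := by
    have := mul_le_mul_of_nonneg_right hθ1 hε.le
    exact mul_le_mul_of_nonneg_right (by linarith) hl0.le
  have hc' := le_abs_self (Real.log C')
  have hc'2 := neg_abs_le (Real.log C')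
  have hYnn : 0 ≤ Real.log C' + X := by linarith
  have hη : (1 - η) * (d / 2 * (Real.log C' + X)) ≤ (1 - θ) * (d / 2 * (Real.log C' + X)) :=
    mul_le_mul_of_nonneg_right (by linarith) (by positivity)
  have h1c' : (1 - θ) * Real.log C' ≤ |Real.log C'| := by
    have h1 := mul_le_mul_of_nonneg_left hc' (by linarith : 0 ≤ 1 - θ)
    have h2 := mul_nonneg hθ.le (abs_nonneg (Real.log C'))
    linarith
  have hl6 : 0 ≤ Real.log 6 := Real.log_nonneg (by norm_num)
  have hl64 : 0 ≤ Real.log 64 := Real.log_nonneg (by norm_num)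
  rw [htarget]
  rcases le_or_gt (Real.log γ - κ * Real.log d) (δ * ℓ) with hβ | hβ
  · have hdT : 8 * d ≤ T := by
      have h : Real.log (8 * d) ≤ Real.log T := by
        rw [Real.log_mul (by norm_num) hd'.ne']
        linarith only [hsmall', hβ, hδε, hT8]
      exact_mod_cast (Real.log_le_log_iff (by positivity) hT').1 h
    have hreg := regretForced_of_log_le hρ (M := (X - δ * ℓ) / 2) hd le_rfl hdT hB0
      (by linarith only [hX, hβ]) (by linarith only [hX, hlγB, hlB])
    refine hreg.mono (hη.trans ?_)
    have h3 := mul_le_mul_of_nonneg_left (show (1 - θ) * (Real.log C' + X) / 2 ≤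
      (X - δ * ℓ) / 2 - Real.log 64 by
        linarith only [hθX, hδℓ, h1c', hTbig, hl6, hl64, abs_nonneg (Real.log C)]) hd'.le
    linarith only [h3]
  · -- Here `γ > T ^ δ`, so `d` is large, and `γ d ≤ T ^ (1 - ε)` because `γ > 1`.
    have hκd : 0 ≤ (κ : ℝ) * Real.log d := by positivity
    have hγδ : (T : ℝ) ^ δ < γ := by
      rw [← Real.log_lt_log_iff (Real.rpow_pos_of_pos hT' _) hγ0, log_natCast_rpow hT0]
      linarith
    have hdθ : 4 / θ ≤ d := hbig.resolve_right (not_le.2 hγδ)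
    have hγ1 : 1 < γ := lt_of_le_of_lt (Real.one_le_rpow (by exact_mod_cast hT0) hδ0.le) hγδ
    have hdγ : γ * d ≤ (T : ℝ) ^ (1 - ε) := by
      rcases le_total ((T : ℝ) ^ (1 - ε)) d with h | h
      · rw [min_eq_left h] at hγd
        exact absurd hγd (not_le.2 (lt_mul_of_one_lt_left hQ hγ1))
      · rwa [min_eq_right h] at hγd
    have hQT : 3 * (T : ℝ) ^ (1 - ε) ≤ T := by
      rw [← Real.log_le_log_iff (by positivity) hT', Real.log_mul (by norm_num) hQ.ne', hlQ]
      linarith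
    have hdκ : (1 : ℝ) ≤ (d : ℝ) ^ κ := one_le_pow₀ hd1
    set β := γ / (d : ℝ) ^ κ with hβdef
    have hβ0 : 0 < β := by positivity
    have hlβ : Real.log β = Real.log γ - κ * Real.log d := by
      rw [hβdef, Real.log_div hγ0.ne' (by positivity), Real.log_pow]
    have hβ3 : 3 ≤ β := by
      rw [← Real.log_le_log_iff (by norm_num) hβ0, hlβ]
      linarith
    have hβγ : β ≤ γ := div_le_self hγ0.le hdκ
    -- The gap `L = 3 log T` is admissible, and `K * L ≤ β log T` keeps the box in the class.
    set K := ⌊β / 3⌋₊ with hKdef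
    have hK1 : 1 ≤ K := Nat.le_floor (by push_cast; linarith)
    have hK1' : (1 : ℝ) ≤ K := by exact_mod_cast hK1
    have hKle : (K : ℝ) ≤ β / 3 := Nat.floor_le (by positivity)
    have hKge : β / 6 ≤ K := by
      have := Nat.lt_floor_add_one (β / 3)
      rw [← hKdef] at this
      linarith
    have h4d : 4 ≤ θ * d := by rwa [div_le_iff₀ hθ, mul_comm] at hdθ
    have h4 : 4 ≤ d := by
      have : (4 : ℝ) ≤ d := h4d.trans (mul_le_of_le_one_left hd'.le hθ1)
      exact_mod_cast this
    obtain ⟨n, rfl⟩ : ∃ n, d = n + 1 := ⟨d - 1, by omega⟩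
    have hn1 : 1 ≤ n := by omega
    have hn' : (0 : ℝ) < n := by exact_mod_cast hn1
    have hnd : ((n + 1 : ℕ) : ℝ) = n + 1 := by push_cast; rfl
    have hnK : (n : ℝ) * K ≤ (T : ℝ) ^ (1 - ε) / 3 := by
      have h1 : (n : ℝ) * K ≤ ((n + 1 : ℕ) : ℝ) * (γ / 3) :=
        mul_le_mul (by rw [hnd]; linarith) (by linarith) (by positivity) (by positivity)
      linarith
    have hT8' : 8 * (n * K) ≤ T := by
      have : 8 * ((n : ℝ) * K) ≤ T := by linarith
      exact_mod_cast this
    have hL : 1 + Real.log (2 * T) ≤ 3 * ℓ := by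
      rw [Real.log_mul (by norm_num) hT'.ne']
      linarith [Real.log_two_lt_d9]
    have hsq : √(((n + 1 : ℕ) : ℝ) ^ κ) ≤ ((n + 1 : ℕ) : ℝ) ^ κ := by
      rw [Real.sqrt_le_left (by positivity)]
      exact le_self_pow₀ hdκ two_ne_zero
    have hKB : K * (3 * ℓ) * √(((n + 1 : ℕ) : ℝ) ^ κ) ≤ B := by
      have h1 : K * (3 * ℓ) ≤ β * ℓ := by
        have := mul_le_mul_of_nonneg_right hKle (by positivity : (0 : ℝ) ≤ 3 * ℓ)
        linarith
      calc K * (3 * ℓ) * √(((n + 1 : ℕ) : ℝ) ^ κ)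
          ≤ β * ℓ * ((n + 1 : ℕ) : ℝ) ^ κ := mul_le_mul h1 hsq (Real.sqrt_nonneg _) (by positivity)
        _ = γ * ℓ := by rw [hβdef]; field_simp
        _ ≤ B := hγB
    have hreg := regretForced_reference hρ hn1 hK1 hT8' hL hKB
    refine hreg.mono (hη.trans ?_)
    have hlog : X - Real.log 6 ≤ Real.log (K * T / n) := by
      have h1 : X - Real.log 6 = Real.log (β / 6 * T / ((n + 1 : ℕ) : ℝ)) := by
        rw [Real.log_div (by positivity) hd'.ne', Real.log_mul (by positivity) hT'.ne',
          Real.log_div hβ0.ne' (by norm_num), hlβ]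
        ring
      rw [h1]
      refine Real.log_le_log (by positivity) ?_
      refine div_le_div₀ (by positivity) (mul_le_mul_of_nonneg_right hKge hT'.le) hn' ?_
      rw [hnd]; linarith
    -- Losing one dimension costs a factor `1 - θ / 4`.
    have hnlow : (1 - θ / 4) * ((n + 1 : ℕ) : ℝ) ≤ n := by
      rw [hnd] at h4d ⊢
      linarith
    set W := X - Real.log 6 - 2 * Real.log 64 with hW
    have hWX : (1 - θ) * (Real.log C' + X) ≤ (1 - θ / 4) * W := by
      have h5 : (1 - θ / 4) * (Real.log 6 + 2 * Real.log 64) ≤ Real.log 6 + 2 * Real.log 64 := by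
        have : 0 ≤ θ / 4 * (Real.log 6 + 2 * Real.log 64) := by positivity
        linarith
      have h6 : (1 - θ / 4) * W = (1 - θ / 4) * X
          - (1 - θ / 4) * (Real.log 6 + 2 * Real.log 64) := by rw [hW]; ring
      linarith only [h6, h5, hW, h1c', hθX, hTbig, abs_nonneg (Real.log C)]
    have hW0 : 0 ≤ W := by
      have h7 : 0 ≤ (1 - θ / 4) * W := le_trans (mul_nonneg (sub_nonneg.2 hθ1) hYnn) hWX
      exact nonneg_of_mul_nonneg_right h7 (by linarith only [hθ1])
    calc (1 - θ) * (((n + 1 : ℕ) : ℝ) / 2 * (Real.log C' + X))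
        = ((n + 1 : ℕ) : ℝ) / 2 * ((1 - θ) * (Real.log C' + X)) := by ring
      _ ≤ ((n + 1 : ℕ) : ℝ) / 2 * ((1 - θ / 4) * W) :=
          mul_le_mul_of_nonneg_left hWX (by positivity)
      _ = (1 - θ / 4) * ((n + 1 : ℕ) : ℝ) * (W / 2) := by ring
      _ ≤ n * (W / 2) := mul_le_mul_of_nonneg_right hnlow (by positivity)
      _ ≤ n * (Real.log (K * T / n) / 2 - Real.log 64) :=
          mul_le_mul_of_nonneg_left (by linarith only [hW, hlog]) hn'.le

/-- From the critical dimension `d₀` on, only about `d₀` coordinates are used. For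
large `T` each of them contributes at least `κ + 1` to the regret. -/
theorem regretForced_above {ρ : ℝ≥0∞} {κ : ℕ} (hρ : BoxBound ρ κ) {ε η δ C : ℝ}
    (hε : 0 < ε) (hη : 0 < η) (hδ : 4 * δ ≤ ε) (hδ1 : 4 * δ ≤ 1) (hC : 0 < C) :
    ∀ᶠ T : ℕ in atTop, ∀ d : ℕ, 1 ≤ d → ∀ B : ℝ, (T : ℝ) ^ (-δ) ≤ B →
      ∀ d₀ : ℝ, 0 ≤ d₀ → d₀ ^ (κ + 1) = C * effGamma ε T d B * (T : ℝ) ^ (1 - ε) → d₀ ≤ d →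
      RegretForced ρ T d B ((1 - η) * ((κ + 1) / 2 * d₀)) := by
  set M : ℝ := Real.log 64 + (κ + 1) with hM
  have hl64 : 0 ≤ Real.log 64 := Real.log_nonneg (by norm_num)
  have hl8 : Real.log 8 ≤ Real.log 64 := Real.log_le_log (by norm_num) (by norm_num)
  filter_upwards [eventually_le_mul_log (a := 1) one_pos 1,
    eventually_le_mul_log (a := 1 / 2) (by positivity) (2 * M),
    eventually_le_mul_log (a := 3 / 4 * ε) (by positivity) (|Real.log C| + 2 * M),
    eventually_gt_atTop 0]
    with T hl1 hTM hTε hT0 d hd B hB d₀ hd₀ hd₀eq hd₀d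
  have hT' : (0 : ℝ) < T := by exact_mod_cast hT0
  rw [one_mul] at hl1
  have hl0 : 0 < Real.log T := by linarith
  have hd' : (0 : ℝ) < d := by exact_mod_cast hd
  have hB0 : 0 < B := (Real.rpow_pos_of_pos hT' _).trans_le hB
  have hγ0 := effGamma_pos (ε := ε) hl0 hd hB0
  have hγB := effGamma_mul_log_le (ε := ε) (d := d) (B := B) hl0
  have hγd := effGamma_mul_min_le (ε := ε) (B := B) hT0 hd
  set γ := effGamma ε T d B with hγ
  set ℓ := Real.log T with hℓ
  have hQ : 0 < (T : ℝ) ^ (1 - ε) := Real.rpow_pos_of_pos hT' _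
  have hlQ : Real.log ((T : ℝ) ^ (1 - ε)) = (1 - ε) * ℓ := log_natCast_rpow hT0 _
  have hlB : -δ * ℓ ≤ Real.log B := by
    rw [← log_natCast_rpow hT0]
    exact Real.log_le_log (Real.rpow_pos_of_pos hT' _) hB
  have hγB' : γ ≤ B := (le_mul_of_one_le_right hγ0.le hl1).trans hγB
  have hlγB : Real.log γ ≤ Real.log B := Real.log_le_log hγ0 hγB'
  have hδε : 4 * δ * ℓ ≤ ε * ℓ := mul_le_mul_of_nonneg_right hδ hl0.le
  have hδℓ : 4 * δ * ℓ ≤ 1 * ℓ := mul_le_mul_of_nonneg_right hδ1 hl0.le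
  have hM0 : 0 ≤ M := by positivity
  have hc := le_abs_self (Real.log C)
  have hc0 := abs_nonneg (Real.log C)
  have hεℓ : 0 < ε * ℓ := mul_pos hε hl0
  -- It suffices to find `k` coordinates, `2 k ≥ d₀`, that satisfy the two
  -- conditions of `regretForced_of_log_le`.
  have hmain : ∀ k : ℕ, 1 ≤ k → k ≤ d → d₀ ≤ 2 * k → 2 * M ≤ ℓ - Real.log k →
      2 * M ≤ 2 * Real.log B + ℓ - (κ + 1) * Real.log k →
      RegretForced ρ T d B ((1 - η) * ((κ + 1) / 2 * d₀)) := by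
    intro k hk hkd hdk h1 h2
    have hk' : (0 : ℝ) < k := by exact_mod_cast hk
    have hkT : 8 * k ≤ T := by
      have h : Real.log (8 * k) ≤ Real.log T := by
        rw [Real.log_mul (by norm_num) hk'.ne']
        have : (0 : ℝ) ≤ κ := Nat.cast_nonneg κ
        linarith
      exact_mod_cast (Real.log_le_log_iff (by positivity) hT').1 h
    refine (regretForced_of_log_le hρ hk hkd hkT hB0 h1 h2).mono ?_
    have h3 : 0 ≤ ((κ : ℝ) + 1) / 2 * d₀ := by positivity
    have h4 := mul_nonneg hη.le h3
    have h5 := mul_le_mul_of_nonneg_left hdk (by positivity : (0 : ℝ) ≤ (κ + 1) / 2)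
    have h6 : M - Real.log 64 = κ + 1 := by rw [hM]; ring
    rw [h6]
    linarith
  rcases lt_or_ge d₀ 1 with h1 | h1
  · refine hmain 1 le_rfl hd (by push_cast; linarith) ?_ ?_ <;>
      simp only [Nat.cast_one, Real.log_one, mul_zero] <;> linarith
  · have hd₀pos : 0 < d₀ := by linarith
    have hl₀ : 0 ≤ Real.log d₀ := Real.log_nonneg h1
    have hκl₀ : 0 ≤ (κ : ℝ) * Real.log d₀ := by positivity
    have heq : (κ + 1) * Real.log d₀ = Real.log C + Real.log γ + (1 - ε) * ℓ := by
      have h := congrArg Real.log hd₀eq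
      rw [Real.log_mul (by positivity) hQ.ne', Real.log_mul hC.ne' hγ0.ne', Real.log_pow, hlQ] at h
      push_cast at h
      exact h
    have hk1 : 1 ≤ ⌊d₀⌋₊ := Nat.le_floor (by simpa using h1)
    have hk1' : (1 : ℝ) ≤ ⌊d₀⌋₊ := by exact_mod_cast hk1
    have hkle : (⌊d₀⌋₊ : ℝ) ≤ d₀ := Nat.floor_le hd₀
    have hlk : Real.log ⌊d₀⌋₊ ≤ Real.log d₀ := Real.log_le_log (by linarith) hkle
    have hκlk : ((κ : ℝ) + 1) * Real.log ⌊d₀⌋₊ ≤ (κ + 1) * Real.log d₀ :=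
      mul_le_mul_of_nonneg_left hlk (by positivity)
    have hl₀ℓ : Real.log d₀ ≤ |Real.log C| + (1 - ε) * ℓ := by
      rcases le_total ((T : ℝ) ^ (1 - ε)) d with h | h
      · rw [min_eq_left h] at hγd
        have hγ1 : γ ≤ 1 := (mul_le_iff_le_one_left hQ).1 hγd
        have := Real.log_nonpos hγ0.le hγ1
        linarith
      · rw [min_eq_right h] at hγd
        have h2 := Real.log_le_log (by positivity) hγd
        rw [Real.log_mul hγ0.ne' hd'.ne', hlQ] at h2
        have h3 := Real.log_le_log hd₀pos hd₀d
        linarith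
    refine hmain ⌊d₀⌋₊ hk1 (by exact_mod_cast hkle.trans hd₀d) ?_ ?_ ?_
    · have := Nat.lt_floor_add_one d₀
      linarith
    · linarith
    · linarith

end OnlineLogistic

theorem mainTheorem1 (ε : ℝ) (hε : 0 < ε) (η : ℝ) (hη : 0 < η) (D : ℕ) :
    ∃ δ : ℝ, 0 < δ ∧ ∃ T₀ D₀ : ℕ, ∀ T : ℕ, T₀ ≤ T → ∀ d : ℕ, 1 ≤ d → ∀ B : ℝ,
      (T : ℝ) ^ (-δ) ≤ B → ∀ γ : ℝ, γ = OnlineLogistic.effGamma ε T d B →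
      -- bounded dimension, any of the three norms
      (d ≤ D → ∀ ρ : ℝ≥0∞, (ρ = 1 ∨ ρ = 2 ∨ ρ = ∞) →
        OnlineLogistic.RegretForced ρ T d B
          ((1 - η) * ((d : ℝ) / 2 * Real.log ((T : ℝ) / d)))) ∧
      -- maximum norm
      ((D₀ ≤ d ∨ γ ≤ (T : ℝ) ^ δ) →
        (d : ℝ) < 4 / Real.exp 1 * γ * (T : ℝ) ^ (1 - ε) →
        OnlineLogistic.RegretForced ∞ T d B
          ((1 - η) * ((d : ℝ) / 2 * Real.log (4 * γ * T / d)))) ∧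
      (4 / Real.exp 1 * γ * (T : ℝ) ^ (1 - ε) ≤ (d : ℝ) →
        OnlineLogistic.RegretForced ∞ T d B
          ((1 - η) * (2 / Real.exp 1 * γ * (T : ℝ) ^ (1 - ε)))) ∧
      -- Euclidean norm
      ((D₀ ≤ d ∨ γ ≤ (T : ℝ) ^ δ) →
        (d : ℝ) < √(2 * Real.pi / Real.exp 1 * γ * (T : ℝ) ^ (1 - ε)) →
        OnlineLogistic.RegretForced 2 T d B
          ((1 - η) * ((d : ℝ) / 2 *
            Real.log (2 * Real.pi * Real.exp 1 * γ * T / (d : ℝ) ^ 2)))) ∧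
      (√(2 * Real.pi / Real.exp 1 * γ * (T : ℝ) ^ (1 - ε)) ≤ (d : ℝ) →
        OnlineLogistic.RegretForced 2 T d B
          ((1 - η) * √(2 * Real.pi / Real.exp 1 * γ * (T : ℝ) ^ (1 - ε)))) ∧
      -- sum norm
      ((D₀ ≤ d ∨ γ ≤ (T : ℝ) ^ δ) →
        (d : ℝ) < (4 * γ * (T : ℝ) ^ (1 - ε) / Real.exp 1) ^ (1 / 3 : ℝ) →
        OnlineLogistic.RegretForced 1 T d B
          ((1 - η) * ((d : ℝ) / 2 *
            Real.log (4 * Real.exp 1 ^ 2 * γ * T / (d : ℝ) ^ 3)))) ∧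
      ((4 * γ * (T : ℝ) ^ (1 - ε) / Real.exp 1) ^ (1 / 3 : ℝ) ≤ (d : ℝ) →
        OnlineLogistic.RegretForced 1 T d B
          ((1 - η) * (3 / 2 *
            (4 * γ * (T : ℝ) ^ (1 - ε) / Real.exp 1) ^ (1 / 3 : ℝ)))) := by
  have hθ : 0 < min η 1 := lt_min hη one_pos
  have hθη : min η 1 ≤ η := min_le_left _ _
  have hθ1 : min η 1 ≤ 1 := min_le_right _ _
  have he : (0 : ℝ) < Real.exp 1 := Real.exp_pos 1
  have hπ := Real.pi_pos
  -- For `η > 1` the claims are weaker than for `η = 1`.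
  generalize min η 1 = θ at hθ hθη hθ1
  have hm : 0 < min ε 1 := lt_min hε one_pos
  have hmε : min ε 1 ≤ ε := min_le_left _ _
  have hm1 : min ε 1 ≤ 1 := min_le_right _ _
  generalize min ε 1 = e₁ at hm hmε hm1
  -- A factor `T ^ δ` changes the logarithm, which is about `ε log T` or more, by at most a
  -- fraction `θ / 4`; a dimension `d ≥ 4 / θ` can afford to lose one coordinate.
  have hδ0 : 0 < θ * e₁ / 4 := by positivity
  have hδθ : 4 * (θ * e₁ / 4) ≤ θ := by nlinarith
  have hδθε : 4 * (θ * e₁ / 4) ≤ θ * ε := by nlinarith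
  have hδε : 4 * (θ * e₁ / 4) ≤ ε := by nlinarith
  generalize θ * e₁ / 4 = δ at hδ0 hδθ hδθε hδε
  have hδ1 : 4 * δ ≤ 1 := hδθ.trans hθ1
  have key := (OnlineLogistic.regretForced_bounded_dim OnlineLogistic.boxBound_one
      hθη hθ hθ1 hδθ D).and
    <| (OnlineLogistic.regretForced_bounded_dim OnlineLogistic.boxBound_two hθη hθ hθ1 hδθ D).and
    <| (OnlineLogistic.regretForced_bounded_dim OnlineLogistic.boxBound_top hθη hθ hθ1 hδθ D).and
    <| (OnlineLogistic.regretForced_below OnlineLogistic.boxBound_top hε hθη hθ hθ1 hδ0 hδθε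
      (C := 4 / Real.exp 1) (C' := 4) (by positivity) (by positivity)).and
    <| (OnlineLogistic.regretForced_above OnlineLogistic.boxBound_top hε hη hδε hδ1
      (C := 4 / Real.exp 1) (by positivity)).and
    <| (OnlineLogistic.regretForced_below OnlineLogistic.boxBound_two hε hθη hθ hθ1 hδ0 hδθε
      (C := 2 * Real.pi / Real.exp 1) (C' := 2 * Real.pi * Real.exp 1)
      (by positivity) (by positivity)).and
    <| (OnlineLogistic.regretForced_above OnlineLogistic.boxBound_two hε hη hδε hδ1
      (C := 2 * Real.pi / Real.exp 1) (by positivity)).and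
    <| (OnlineLogistic.regretForced_below OnlineLogistic.boxBound_one hε hθη hθ hθ1 hδ0 hδθε
      (C := 4 / Real.exp 1) (C' := 4 * Real.exp 1 ^ 2) (by positivity) (by positivity)).and
    <| (OnlineLogistic.regretForced_above OnlineLogistic.boxBound_one hε hη hδε hδ1
      (C := 4 / Real.exp 1) (by positivity)).and (Filter.eventually_gt_atTop 1)
  obtain ⟨T₀, hT₀⟩ := Filter.eventually_atTop.1 key
  obtain ⟨D₀, hD₀⟩ := exists_nat_ge (4 / θ)
  refine ⟨δ, hδ0, T₀, D₀, fun T hT d hd B hB γ hγ => ?_⟩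
  obtain ⟨b1, b2, b3, topLow, topHigh, twoLow, twoHigh, oneLow, oneHigh, hT1⟩ := hT₀ T hT
  have hT1' : (1 : ℝ) < T := by exact_mod_cast hT1
  have hT0 : (0 : ℝ) < T := by linarith
  have hγ0 : 0 < OnlineLogistic.effGamma ε T d B := OnlineLogistic.effGamma_pos
    (Real.log_pos hT1') hd ((Real.rpow_pos_of_pos hT0 _).trans_le hB)
  have hQ : 0 < (T : ℝ) ^ (1 - ε) := Real.rpow_pos_of_pos hT0 _
  have hbig : (D₀ ≤ d ∨ γ ≤ (T : ℝ) ^ δ) →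
      4 / θ ≤ d ∨ OnlineLogistic.effGamma ε T d B ≤ (T : ℝ) ^ δ := by
    rw [← hγ]
    exact Or.imp_left fun h => hD₀.trans (by exact_mod_cast h)
  have topLow := topLow d hd B hB
  have topHigh := topHigh d hd B hB
  have twoLow := twoLow d hd B hB
  have twoHigh := twoHigh d hd B hB
  have oneLow := oneLow d hd B hB
  have oneHigh := oneHigh d hd B hB
  rw [← hγ] at hγ0 hbig topLow topHigh twoLow twoHigh oneLow oneHigh
  have hcube : ((4 * γ * (T : ℝ) ^ (1 - ε) / Real.exp 1) ^ (1 / 3 : ℝ)) ^ (2 + 1)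
      = 4 / Real.exp 1 * γ * (T : ℝ) ^ (1 - ε) := by
    rw [← Real.rpow_natCast, ← Real.rpow_mul (by positivity)]
    norm_num
    ring
  refine ⟨?_, ?_, ?_, ?_, ?_, ?_, ?_⟩
  · rintro hdD ρ (rfl | rfl | rfl)
    · exact b1 d hd hdD B hB
    · exact b2 d hd hdD B hB
    · exact b3 d hd hdD B hB
  · intro h1 h2
    simpa using topLow (hbig h1) (by simpa using h2)
  · intro h
    refine (topHigh _ (by positivity) (by simp) h).mono (le_of_eq ?_)
    push_cast
    ring
  · intro h1 h2
    exact twoLow (hbig h1) ((Real.lt_sqrt (Nat.cast_nonneg d)).1 h2)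
  · intro h
    refine (twoHigh _ (Real.sqrt_nonneg _) (Real.sq_sqrt (by positivity)) h).mono (le_of_eq ?_)
    push_cast
    ring
  · intro h1 h2
    refine oneLow (hbig h1) ?_
    rw [← hcube]
    exact pow_lt_pow_left₀ h2 (Nat.cast_nonneg d) (by norm_num)
  · intro h
    refine (oneHigh _ (Real.rpow_nonneg (by positivity) _) hcube h).mono (le_of_eq ?_)
    push_cast
    ring
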